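/- Let $SE(3)=SO(3)\ltimes\mathbb{R}^3$ be the group of displacements $x\mapsto Rx+r$ of Euclidean 3-space ($R\in SO(3)$, $r\in\mathbb{R}^3$). It acts on its Lie algebra $\mathfrak{se}(3)\cong\mathbb{R}^3\times\mathbb{R}^3$, whose elements $(\omega,v)$ are called screws, by the adjoint action $(R,r)\cdot(\omega,v)=(R\omega,\ r\times R\omega+Rv)$. Let $SE(3)$ act diagonally on pairs of screws $(\omega_1,v_1,\omega_2,v_2)\in\mathbb{R}^{12}$, and let $\mathbb{R}[\omega_1,v_1,\omega_2,v_2]^{SE(3)}$ be the ring of those real polynomials $f$ in the 12 coordinates that satisfy $f(g\cdot s)=f(s)$ for all $g\in SE(3)$ and all pairs of screws $s$. Then $\mathbb{R}[\omega_1,v_1,\omega_2,v_2]^{SE(3)}$ is generated, as an $\mathbb{R}$-algebra, by $$\omega_i\cdot\omega_j\ (1\le i,j\le 2),\qquad \omega_1\cdot v_1,\quad \omega_2\cdot v_2,\qquad \omega_1\cdot v_2+\omega_2\cdot v_1 .$$ -/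

import Mathlib

open Matrix MvPolynomial

namespace Screws

/-- The special Euclidean group `SE(3) = SO(3) ⋉ ℝ³`: a pair `(R, r)` is the displacement
`x ↦ R x + r` of Euclidean 3-space. -/
@[ext]
structure SE3 where
  /-- the rotation part `R` -/
  rot : Matrix.specialOrthogonalGroup (Fin 3) ℝ
  /-- the translation part `r` -/
  trans : Fin 3 → ℝ

namespace SE3

/-- Composition of displacements. -/
instance : Mul SE3 where
  mul g h := ⟨g.rot * h.rot, (g.rot : Matrix (Fin 3) (Fin 3) ℝ) *ᵥ h.trans + g.trans⟩

instance : One SE3 where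
  one := ⟨1, 0⟩

instance : Inv SE3 where
  inv g := ⟨g.rot⁻¹, -(((g.rot⁻¹ : Matrix.specialOrthogonalGroup (Fin 3) ℝ) :
    Matrix (Fin 3) (Fin 3) ℝ) *ᵥ g.trans)⟩

@[simp] theorem mul_rot (g h : SE3) : (g * h).rot = g.rot * h.rot := rfl

@[simp] theorem mul_trans (g h : SE3) :
    (g * h).trans = (g.rot : Matrix (Fin 3) (Fin 3) ℝ) *ᵥ h.trans + g.trans := rfl

@[simp] theorem one_rot : (1 : SE3).rot = 1 := rfl

@[simp] theorem one_trans : (1 : SE3).trans = 0 := rfl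

@[simp] theorem inv_rot (g : SE3) : (g⁻¹).rot = g.rot⁻¹ := rfl

@[simp] theorem inv_trans (g : SE3) :
    (g⁻¹).trans = -(((g.rot⁻¹ : Matrix.specialOrthogonalGroup (Fin 3) ℝ) :
      Matrix (Fin 3) (Fin 3) ℝ) *ᵥ g.trans) := rfl

instance : Group SE3 :=
  Group.ofLeftAxioms
    (fun a b c => by
      apply SE3.ext
      · simp [mul_assoc]
      · simp [Matrix.mulVec_add, add_assoc])
    (fun a => by
      apply SE3.ext
      · simp
      · simp)
    (fun a => by
      apply SE3.ext
      · simp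
      · simp)

end SE3

/-- The skew-symmetric matrix `T` of a vector `t`, so that `T x = t × x`. -/
def skew (t : Fin 3 → ℝ) : Matrix (Fin 3) (Fin 3) ℝ :=
  !![0, -t 2, t 1; t 2, 0, -t 0; -t 1, t 0, 0]

/-- A screw (twist), that is an element of the Lie algebra `se(3)`, given by its Plücker
coordinates `(ω, v)`; it stands for the pair `(Ω, v)` with `Ω = skew ω`. -/
@[ext]
structure Screw where
  /-- the rotational part -/
  ω : Fin 3 → ℝ
  /-- the translational part -/
  v : Fin 3 → ℝ

theorem transpose_mul_skew_mul (M : Matrix (Fin 3) (Fin 3) ℝ) (t : Fin 3 → ℝ) :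
    Mᵀ * skew (M *ᵥ t) * M = M.det • skew t := by
  ext i j
  fin_cases i <;> fin_cases j <;>
    simp [skew, Matrix.mul_apply, Fin.sum_univ_three, Matrix.mulVec, dotProduct,
      Matrix.det_fin_three] <;> ring

theorem skew_mulVec_mul (R : Matrix.specialOrthogonalGroup (Fin 3) ℝ) (t : Fin 3 → ℝ) :
    skew ((R : Matrix (Fin 3) (Fin 3) ℝ) *ᵥ t) * (R : Matrix (Fin 3) (Fin 3) ℝ) =
      (R : Matrix (Fin 3) (Fin 3) ℝ) * skew t := by
  obtain ⟨M, hM⟩ := R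
  obtain ⟨hO, hdet⟩ := Matrix.mem_specialOrthogonalGroup_iff.1 hM
  have hMM : M * Mᵀ = 1 := (Matrix.mem_orthogonalGroup_iff (Fin 3) ℝ).1 hO
  have h := transpose_mul_skew_mul M t
  rw [hdet, one_smul] at h
  change skew (M *ᵥ t) * M = M * skew t
  rw [← h, ← Matrix.mul_assoc, ← Matrix.mul_assoc, hMM, Matrix.one_mul]

theorem skew_add (s t : Fin 3 → ℝ) : skew (s + t) = skew s + skew t := by
  ext i j
  fin_cases i <;> fin_cases j <;> simp [skew] <;> ring

theorem skew_zero : skew 0 = 0 := by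
  ext i j
  fin_cases i <;> fin_cases j <;> simp [skew]

/-- The adjoint action of `SE(3)` on its Lie algebra, in Plücker coordinates: with `T = skew r`,
`(R, r) • (ω, v) = (R ω, T R ω + R v)`. -/
instance : SMul SE3 Screw where
  smul g s :=
    ⟨(g.rot : Matrix (Fin 3) (Fin 3) ℝ) *ᵥ s.ω,
      (skew g.trans * (g.rot : Matrix (Fin 3) (Fin 3) ℝ)) *ᵥ s.ω +
        (g.rot : Matrix (Fin 3) (Fin 3) ℝ) *ᵥ s.v⟩

@[simp] theorem smul_ω (g : SE3) (s : Screw) :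
    (g • s).ω = (g.rot : Matrix (Fin 3) (Fin 3) ℝ) *ᵥ s.ω := rfl

@[simp] theorem smul_v (g : SE3) (s : Screw) :
    (g • s).v = (skew g.trans * (g.rot : Matrix (Fin 3) (Fin 3) ℝ)) *ᵥ s.ω +
      (g.rot : Matrix (Fin 3) (Fin 3) ℝ) *ᵥ s.v := rfl

instance : MulAction SE3 Screw where
  one_smul s := by
    apply Screw.ext
    · simp
    · simp [skew_zero]
  mul_smul g h s := by
    apply Screw.ext
    · simp
    · simp only [smul_v, smul_ω, SE3.mul_trans, SE3.mul_rot, Submonoid.coe_mul, skew_add,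
        Matrix.add_mul, Matrix.add_mulVec, Matrix.mulVec_add, Matrix.mulVec_mulVec]
      rw [← Matrix.mul_assoc (skew _), skew_mulVec_mul]
      simp only [Matrix.mul_assoc]
      abel

/-- The coordinates of a `k`-screw: `(i, Sum.inl n)` labels the `n`-th coordinate of `ωᵢ`, and
`(i, Sum.inr n)` the `n`-th coordinate of `vᵢ`. -/
abbrev Coord (k : ℕ) : Type := Fin k × (Fin 3 ⊕ Fin 3)

/-- The point of `ℝ^(6k)` with the Plücker coordinates of a `k`-screw. -/
def coords {k : ℕ} (s : Fin k → Screw) : Coord k → ℝ :=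
  fun c => Sum.elim (s c.1).ω (s c.1).v c.2

/-- The ring of polynomial invariants of `SE(3)` acting diagonally by the adjoint action on
`k`-screws: the polynomials `f` with `f (g • s) = f s` for all `g` and `s`. -/
noncomputable def invariantRing (k : ℕ) : Subalgebra ℝ (MvPolynomial (Coord k) ℝ) where
  carrier := {f | ∀ (g : SE3) (s : Fin k → Screw), eval (coords (g • s)) f = eval (coords s) f}
  mul_mem' := by
    intro a b ha hb g s
    rw [map_mul, map_mul, ha g s, hb g s]
  add_mem' := by
    intro a b ha hb g s
    rw [map_add, map_add, ha g s, hb g s]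
  algebraMap_mem' := by
    intro r g s
    simp [MvPolynomial.algebraMap_eq]

/-- The vector `ωᵢ` of coordinate polynomials. -/
noncomputable def omegaVar {k : ℕ} (i : Fin k) : Fin 3 → MvPolynomial (Coord k) ℝ :=
  fun n => X (i, Sum.inl n)

/-- The vector `vᵢ` of coordinate polynomials. -/
noncomputable def vVar {k : ℕ} (i : Fin k) : Fin 3 → MvPolynomial (Coord k) ℝ :=
  fun n => X (i, Sum.inr n)

end Screws

namespace Screws

/-! A generic pair of screws can be moved to a normal form whose entries are rational in the six
invariants, up to the signs of two square roots: `x` of `ω₁·ω₁` and `z` of the Gram determinant `d`.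
An invariant `f` takes the same value on all four sign choices, so averaging removes the odd terms
and makes `((ω₁·ω₁) d) ^ N * f` a polynomial in the generators (`exists_pow_mul_mem_range`).

The denominators are then cancelled one factor at a time. If `φ D * h = φ P`, with `φ` substitution
of the generators and `D` one of the factors, then `P` vanishes at the invariants of every point
where `φ D` does. Enough points have to be found on `D = 0` to force `D ∣ P`. Real points do not
suffice: `ω₁·ω₁ = 0` forces `ω₁ = 0`, and `d = 0` makes `ω₁, ω₂` parallel, so further relations hold
among the invariants. Isotropic complex vectors avoid this (`mem_range_of_gens_zero_mul`,
`mem_range_of_gram_mul`). Algebraic independence of the generators is not needed. -/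

/-! ### The generators and their invariance -/

/-- The six generating invariants, in the order
`ω₁·ω₁, ω₁·ω₂, ω₂·ω₂, ω₁·v₁, ω₂·v₂, ω₁·v₂ + ω₂·v₁`. -/
noncomputable def gens : Fin 6 → MvPolynomial (Coord 2) ℝ :=
  ![omegaVar 0 ⬝ᵥ omegaVar 0, omegaVar 0 ⬝ᵥ omegaVar 1, omegaVar 1 ⬝ᵥ omegaVar 1,
    omegaVar 0 ⬝ᵥ vVar 0, omegaVar 1 ⬝ᵥ vVar 1,
    omegaVar 0 ⬝ᵥ vVar 1 + omegaVar 1 ⬝ᵥ vVar 0]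

theorem adjoin_eq_range_aeval_gens :
    Algebra.adjoin ℝ
        ({p | ∃ i j : Fin 2, p = omegaVar i ⬝ᵥ omegaVar j} ∪
          {p | ∃ i : Fin 2, p = omegaVar i ⬝ᵥ vVar i} ∪
          {omegaVar 0 ⬝ᵥ vVar 1 + omegaVar 1 ⬝ᵥ vVar 0}) =
      (aeval (R := ℝ) gens).range := by
  rw [← Algebra.adjoin_range_eq_range_aeval]
  congr 1
  ext p
  constructor
  · rintro ((⟨i, j, rfl⟩ | ⟨i, rfl⟩) | rfl)
    · fin_cases i <;> fin_cases j
      · exact ⟨0, rfl⟩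
      · exact ⟨1, rfl⟩
      · exact ⟨1, dotProduct_comm (omegaVar 0) (omegaVar 1)⟩
      · exact ⟨2, rfl⟩
    · fin_cases i
      · exact ⟨3, rfl⟩
      · exact ⟨4, rfl⟩
    · exact ⟨5, rfl⟩
  · rintro ⟨i, rfl⟩
    fin_cases i
    · exact Or.inl (Or.inl ⟨0, 0, rfl⟩)
    · exact Or.inl (Or.inl ⟨0, 1, rfl⟩)
    · exact Or.inl (Or.inl ⟨1, 1, rfl⟩)
    · exact Or.inl (Or.inr ⟨0, rfl⟩)
    · exact Or.inl (Or.inr ⟨1, rfl⟩)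
    · exact Or.inr rfl

/-- The values of the six invariants at a pair of screws. -/
def invariants (s : Fin 2 → Screw) : Fin 6 → ℝ :=
  ![(s 0).ω ⬝ᵥ (s 0).ω, (s 0).ω ⬝ᵥ (s 1).ω, (s 1).ω ⬝ᵥ (s 1).ω,
    (s 0).ω ⬝ᵥ (s 0).v, (s 1).ω ⬝ᵥ (s 1).v, (s 0).ω ⬝ᵥ (s 1).v + (s 1).ω ⬝ᵥ (s 0).v]

theorem eval_gens (s : Fin 2 → Screw) (i : Fin 6) :
    eval (coords s) (gens i) = invariants s i := by
  fin_cases i <;>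
    simp [gens, invariants, omegaVar, vVar, coords, dotProduct, Fin.sum_univ_three]

theorem eval_aeval_gens (s : Fin 2 → Screw) (P : MvPolynomial (Fin 6) ℝ) :
    eval (coords s) (aeval gens P) = eval (invariants s) P := by
  have : (aeval (coords s)).comp (aeval (R := ℝ) gens) = aeval (invariants s) := by
    ext i
    simpa [MvPolynomial.aeval_eq_eval] using eval_gens s i
  simpa [MvPolynomial.aeval_eq_eval] using DFunLike.congr_fun this P

theorem rot_dotProduct_rot (R : Matrix.specialOrthogonalGroup (Fin 3) ℝ) (x y : Fin 3 → ℝ) :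
    ((R : Matrix (Fin 3) (Fin 3) ℝ) *ᵥ x) ⬝ᵥ ((R : Matrix (Fin 3) (Fin 3) ℝ) *ᵥ y) =
      x ⬝ᵥ y := by
  have h : (R : Matrix (Fin 3) (Fin 3) ℝ)ᵀ * (R : Matrix (Fin 3) (Fin 3) ℝ) = 1 :=
    (Matrix.mem_orthogonalGroup_iff' (Fin 3) ℝ).1 (Matrix.mem_specialOrthogonalGroup_iff.1 R.2).1
  rw [dotProduct_mulVec, ← Matrix.mulVec_transpose, Matrix.mulVec_mulVec, h, Matrix.one_mulVec]

theorem dotProduct_skew_mulVec_self (t x : Fin 3 → ℝ) : x ⬝ᵥ (skew t *ᵥ x) = 0 := by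
  simp [skew, dotProduct, Matrix.mulVec, Fin.sum_univ_three]
  ring

theorem dotProduct_skew_mulVec_add (t x y : Fin 3 → ℝ) :
    x ⬝ᵥ (skew t *ᵥ y) + y ⬝ᵥ (skew t *ᵥ x) = 0 := by
  simp [skew, dotProduct, Matrix.mulVec, Fin.sum_univ_three]
  ring

theorem invariants_smul (g : SE3) (s : Fin 2 → Screw) : invariants (g • s) = invariants s := by
  ext i
  fin_cases i
  · simp [invariants, rot_dotProduct_rot]
  · simp [invariants, rot_dotProduct_rot]
  · simp [invariants, rot_dotProduct_rot]
  · simp [invariants, rot_dotProduct_rot, ← Matrix.mulVec_mulVec, dotProduct_add,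
      dotProduct_skew_mulVec_self]
  · simp [invariants, rot_dotProduct_rot, ← Matrix.mulVec_mulVec, dotProduct_add,
      dotProduct_skew_mulVec_self]
  · have h := dotProduct_skew_mulVec_add g.trans
      ((g.rot : Matrix (Fin 3) (Fin 3) ℝ) *ᵥ (s 0).ω)
      ((g.rot : Matrix (Fin 3) (Fin 3) ℝ) *ᵥ (s 1).ω)
    simp only [invariants, Pi.smul_apply, smul_ω, smul_v, ← Matrix.mulVec_mulVec, dotProduct_add,
      rot_dotProduct_rot]
    change _ + _ + (_ + _) = _ + _
    linarith

theorem range_aeval_gens_le : (aeval (R := ℝ) gens).range ≤ invariantRing 2 := by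
  rintro _ ⟨P, rfl⟩ g s
  change eval _ (aeval gens P) = eval _ (aeval gens P)
  rw [eval_aeval_gens, eval_aeval_gens, invariants_smul]

/-! ### The normal form of a generic pair -/

/-- The Gram determinant of `ω₁, ω₂` in terms of the six invariants. -/
noncomputable def gram : MvPolynomial (Fin 6) ℝ := X 0 * X 2 - X 1 ^ 2

/-- A normal form of a pair of screws with invariants `I`, where `x ^ 2 = ω₁·ω₁` and `z ^ 2` is
the Gram determinant `d` of `ω₁, ω₂`. -/
noncomputable def slice (I : Fin 6 → ℝ) (d x z : ℝ) : Fin 2 → Screw :=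
  ![⟨![x, 0, 0], ![I 3 * x / I 0, (I 5 - I 1 * I 3 / I 0) * (x * z) / d, 0]⟩,
    ⟨![I 1 * x / I 0, x * z / I 0, 0], ![0, I 4 * (x * z) / d, 0]⟩]

/-- Each coordinate of `slice`, times `I 0 * d`, is a combination of `x` and `x * z` with
coefficients polynomial in `I`; since `x ^ 2` and `z ^ 2` are also polynomial in `I`, the span of
`1, x, z, x * z` is closed under multiplication. -/
theorem exists_eval_slice (f : MvPolynomial (Coord 2) ℝ) :
    ∃ (N : ℕ) (G₀ G₁ G₂ G₃ : MvPolynomial (Fin 6) ℝ), ∀ (I : Fin 6 → ℝ) (d x z : ℝ),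
      d = eval I gram → I 0 ≠ 0 → d ≠ 0 → x ^ 2 = I 0 → z ^ 2 = d →
      (I 0 * d) ^ N * eval (coords (slice I d x z)) f =
        eval I G₀ + x * eval I G₁ + z * eval I G₂ + x * z * eval I G₃ := by
  induction f using MvPolynomial.induction_on with
  | C r => exact ⟨0, C r, 0, 0, 0, fun I d x z _ _ _ _ _ => by simp⟩
  | add f g hf hg =>
    obtain ⟨N, G₀, G₁, G₂, G₃, hf⟩ := hf
    obtain ⟨M, H₀, H₁, H₂, H₃, hg⟩ := hg
    refine ⟨N + M, (X 0 * gram) ^ M * G₀ + (X 0 * gram) ^ N * H₀,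
      (X 0 * gram) ^ M * G₁ + (X 0 * gram) ^ N * H₁,
      (X 0 * gram) ^ M * G₂ + (X 0 * gram) ^ N * H₂,
      (X 0 * gram) ^ M * G₃ + (X 0 * gram) ^ N * H₃, fun I d x z hd hI hd0 hx hz => ?_⟩
    have h1 := hf I d x z hd hI hd0 hx hz
    have h2 := hg I d x z hd hI hd0 hx hz
    simp only [map_add, map_mul, map_pow, eval_X, ← hd]
    linear_combination (I 0 * d) ^ M * h1 + (I 0 * d) ^ N * h2
  | mul_X f c hf =>
    obtain ⟨N, G₀, G₁, G₂, G₃, hf⟩ := hf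
    have key : ∃ A B : MvPolynomial (Fin 6) ℝ, ∀ (I : Fin 6 → ℝ) (d x z : ℝ),
        d = eval I gram → I 0 ≠ 0 → d ≠ 0 →
        I 0 * d * coords (slice I d x z) c = x * eval I A + x * z * eval I B := by
      obtain ⟨i, n | n⟩ := c <;> fin_cases i <;> fin_cases n
      · exact ⟨X 0 * gram, 0, fun I d x z hd hI hd0 => by simp [coords, slice, ← hd]; ring⟩
      · exact ⟨0, 0, fun I d x z hd hI hd0 => by simp [coords, slice]⟩
      · exact ⟨0, 0, fun I d x z hd hI hd0 => by simp [coords, slice]⟩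
      · exact ⟨X 1 * gram, 0, fun I d x z hd hI hd0 => by
          simp [coords, slice, ← hd]; field_simp⟩
      · exact ⟨0, gram, fun I d x z hd hI hd0 => by simp [coords, slice, ← hd]; field_simp⟩
      · exact ⟨0, 0, fun I d x z hd hI hd0 => by simp [coords, slice]⟩
      · exact ⟨X 3 * gram, 0, fun I d x z hd hI hd0 => by
          simp [coords, slice, ← hd]; field_simp⟩
      · exact ⟨0, X 0 * X 5 - X 1 * X 3, fun I d x z hd hI hd0 => by
          simp [coords, slice]; field_simp⟩
      · exact ⟨0, 0, fun I d x z hd hI hd0 => by simp [coords, slice]⟩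
      · exact ⟨0, 0, fun I d x z hd hI hd0 => by simp [coords, slice]⟩
      · exact ⟨0, X 0 * X 4, fun I d x z hd hI hd0 => by
          simp [coords, slice]; field_simp⟩
      · exact ⟨0, 0, fun I d x z hd hI hd0 => by simp [coords, slice]⟩
    obtain ⟨A, B, key⟩ := key
    refine ⟨N + 1, X 0 * A * G₁ + X 0 * gram * B * G₃, A * G₀ + gram * B * G₂,
      X 0 * (A * G₃ + B * G₁), A * G₂ + B * G₀, fun I d x z hd hI hd0 hx hz => ?_⟩
    have h1 := hf I d x z hd hI hd0 hx hz
    have h2 := key I d x z hd hI hd0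
    simp only [map_add, map_mul, eval_X, ← hd]
    rw [pow_succ, mul_mul_mul_comm, h1, h2, ← hx, ← hz]
    ring

/-- Gram–Schmidt. Both signs of `x` and of `z` are allowed, because the third axis is free to
restore the orientation; the sign averaging depends on this. -/
theorem exists_rot_smul_eq (s : Fin 2 → Screw) (x y z : ℝ) (hx : x ≠ 0) (hz : z ≠ 0)
    (h00 : (s 0).ω ⬝ᵥ (s 0).ω = x ^ 2) (h01 : (s 0).ω ⬝ᵥ (s 1).ω = x * y)
    (h11 : (s 1).ω ⬝ᵥ (s 1).ω = y ^ 2 + z ^ 2) :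
    ∃ g : SE3, (g • s 0).ω = ![x, 0, 0] ∧ (g • s 1).ω = ![y, z, 0] := by
  set u := (s 0).ω
  set w := (s 1).ω
  let e : Fin 3 → ℝ := x⁻¹ • u
  let e' : Fin 3 → ℝ := z⁻¹ • (w - y • e)
  have hue : e ⬝ᵥ u = x := by
    simp only [e, smul_dotProduct, h00, smul_eq_mul]; field_simp
  have hwe : e ⬝ᵥ w = y := by
    simp only [e, smul_dotProduct, h01, smul_eq_mul]; field_simp
  have hue' : e' ⬝ᵥ u = 0 := by
    simp only [e', smul_dotProduct, sub_dotProduct, hue, dotProduct_comm w u, h01, smul_eq_mul]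
    ring
  have hwe' : e' ⬝ᵥ w = z := by
    simp only [e', smul_dotProduct, sub_dotProduct, hwe, h11, smul_eq_mul]
    field_simp; ring
  have hee : e ⬝ᵥ e = 1 := by
    change e ⬝ᵥ (x⁻¹ • u) = 1
    rw [dotProduct_smul, hue, smul_eq_mul, inv_mul_cancel₀ hx]
  have hee' : e' ⬝ᵥ e = 0 := by
    change e' ⬝ᵥ (x⁻¹ • u) = 0
    rw [dotProduct_smul, hue', smul_zero]
  have he'e' : e' ⬝ᵥ e' = 1 := by
    change e' ⬝ᵥ (z⁻¹ • (w - y • e)) = 1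
    rw [dotProduct_smul, dotProduct_sub, dotProduct_smul, hwe', hee', smul_zero, sub_zero,
      smul_eq_mul, inv_mul_cancel₀ hz]
  have hu : u = x • e := by simp [e, smul_smul, hx]
  have hw : w = y • e + z • e' := by simp [e', smul_smul, hz]
  have hcross : (e ⨯₃ e') ⬝ᵥ (e ⨯₃ e') = 1 := by
    rw [cross_dot_cross, hee, he'e', dotProduct_comm e e', hee']; simp
  -- Taking the cross product as third row makes the determinant `1` rather than `-1`.
  let M : Matrix (Fin 3) (Fin 3) ℝ := ![e, e', e ⨯₃ e']
  have hM : M * Mᵀ = 1 := by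
    have hr (i j) : (M * Mᵀ) i j = M i ⬝ᵥ M j := rfl
    ext i j
    rw [hr]
    fin_cases i <;> fin_cases j <;>
      simp [M, hee, hee', he'e', hcross, dotProduct_comm e e', dot_self_cross,
        dot_cross_self, dotProduct_comm (e ⨯₃ e') _]
  have hdet : M.det = 1 := by
    have : M.det = (e ⨯₃ e') ⬝ᵥ (e ⨯₃ e') := by
      rw [Matrix.det_fin_three]
      simp [M, cross_apply, dotProduct, Fin.sum_univ_three]
      ring
    rw [this, hcross]
  refine ⟨⟨⟨M, Matrix.mem_specialOrthogonalGroup_iff.2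
    ⟨(Matrix.mem_orthogonalGroup_iff (Fin 3) ℝ).2 hM, hdet⟩⟩, 0⟩, ?_, ?_⟩
  · change M *ᵥ u = _
    have hr (i) : (M *ᵥ u) i = M i ⬝ᵥ u := rfl
    ext i
    rw [hr]
    fin_cases i
    · simpa [M] using hue
    · simpa [M] using hue'
    · simp [M, hu, dotProduct_comm (e ⨯₃ e') _]
  · change M *ᵥ w = _
    have hr (i) : (M *ᵥ w) i = M i ⬝ᵥ w := rfl
    ext i
    rw [hr]
    fin_cases i
    · simpa [M] using hwe
    · simpa [M] using hwe'
    · simp [M, hw, dotProduct_comm (e ⨯₃ e') _]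

/-- A translation has three parameters, which kill three of the six coordinates of `v₁, v₂`; the
three linear invariants in `v` determine the others. -/
theorem exists_trans_smul_eq (s : Fin 2 → Screw) (x y z : ℝ) (hx : x ≠ 0) (hz : z ≠ 0)
    (h0 : (s 0).ω = ![x, 0, 0]) (h1 : (s 1).ω = ![y, z, 0]) :
    ∃ g : SE3, g • s = ![⟨![x, 0, 0], ![invariants s 3 / x,
        (invariants s 5 - y * (invariants s 3 / x)) / z, 0]⟩,
      ⟨![y, z, 0], ![0, invariants s 4 / z, 0]⟩] := by
  -- Solves for the vanishing of the last coordinate of `v₁` and the first and last of `v₂`.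
  let r : Fin 3 → ℝ :=
    ![((s 0).v 2 / x * y - (s 1).v 2) / z, (s 0).v 2 / x, (s 1).v 0 / z]
  refine ⟨⟨1, r⟩, ?_⟩
  ext i n
  · fin_cases i
    · simp [h0]
    · simp [h1]
  · fin_cases i <;> fin_cases n <;>
      simp [h0, h1, r, skew, invariants, dotProduct, Fin.sum_univ_three] <;>
      field_simp <;> ring

theorem exists_smul_eq_slice (s : Fin 2 → Screw) (d x z : ℝ)
    (hd : d = eval (invariants s) gram) (hI : invariants s 0 ≠ 0) (hd0 : d ≠ 0)
    (hx : x ^ 2 = invariants s 0) (hz : z ^ 2 = d) :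
    ∃ g : SE3, g • s = slice (invariants s) d x z := by
  have hx0 : x ≠ 0 := by rintro rfl; exact hI (by rw [← hx]; simp)
  have hz0 : z ≠ 0 := by rintro rfl; exact hd0 (by rw [← hz]; simp)
  obtain ⟨g, h0, h1⟩ := exists_rot_smul_eq s x (invariants s 1 / x) (z / x) hx0
    (div_ne_zero hz0 hx0) hx.symm (by rw [mul_div_cancel₀ _ hx0]; rfl) (by
      have : d = invariants s 0 * invariants s 2 - invariants s 1 ^ 2 := by
        rw [hd]; simp [gram]
      change invariants s 2 = _
      rw [← hx, ← hz] at this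
      field_simp
      linarith)
  obtain ⟨g', hg'⟩ := exists_trans_smul_eq (g • s) _ _ _ hx0 (div_ne_zero hz0 hx0) h0 h1
  refine ⟨g' * g, ?_⟩
  rw [mul_smul, hg', invariants_smul, slice, ← hx, ← hz]
  congr! 3 <;> field_simp


/-! ### Invariants up to a denominator -/

theorem eval_gram (I : Fin 6 → ℝ) : eval I gram = I 0 * I 2 - I 1 ^ 2 := by simp [gram]

theorem gens_zero_ne_zero : gens 0 ≠ 0 := by
  intro h
  have := congrArg (eval (coords (fun _ => ⟨![1, 0, 0], 0⟩))) h
  rw [eval_gens] at this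
  simp [invariants] at this

theorem aeval_gens_gram_ne_zero : aeval gens gram ≠ 0 := by
  intro h
  have := congrArg (eval (coords ![⟨![1, 0, 0], 0⟩, ⟨![0, 1, 0], 0⟩])) h
  rw [eval_aeval_gens, eval_gram] at this
  simp [invariants] at this

/-- An invariant becomes a polynomial in the generators after multiplication by a power of
`(ω₁·ω₁) d`, where `d` is the Gram determinant. -/
theorem exists_pow_mul_mem_range {f : MvPolynomial (Coord 2) ℝ} (hf : f ∈ invariantRing 2) :
    ∃ N : ℕ, (gens 0 * aeval gens gram) ^ N * f ∈ (aeval (R := ℝ) gens).range := by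
  obtain ⟨N, G₀, G₁, G₂, G₃, hG⟩ := exists_eval_slice f
  refine ⟨N, G₀, ?_⟩
  change aeval gens G₀ = _
  -- With this extra factor, the identity need only be checked where the normal form exists.
  refine mul_left_cancel₀ (mul_ne_zero gens_zero_ne_zero aeval_gens_gram_ne_zero) ?_
  refine MvPolynomial.funext fun w => ?_
  obtain ⟨s, rfl⟩ : ∃ s, coords s = w :=
    ⟨fun i => ⟨fun n => w (i, Sum.inl n), fun n => w (i, Sum.inr n)⟩, by
      ext ⟨i, n | n⟩ <;> rfl⟩
  simp only [map_mul, map_pow, eval_gens, eval_aeval_gens]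
  by_cases hI : invariants s 0 = 0
  · simp [hI]
  by_cases hd : eval (invariants s) gram = 0
  · simp [hd]
  congr 1
  have hI' : 0 ≤ invariants s 0 := by
    simp [invariants, dotProduct, Fin.sum_univ_three]; nlinarith
  have hd' : 0 ≤ eval (invariants s) gram := by
    have h := cross_dot_cross (s 0).ω (s 1).ω (s 0).ω (s 1).ω
    have h' : 0 ≤ ((s 0).ω ⨯₃ (s 1).ω) ⬝ᵥ ((s 0).ω ⨯₃ (s 1).ω) :=
      Finset.sum_nonneg fun i _ => mul_self_nonneg _
    rw [h, dotProduct_comm (s 1).ω (s 0).ω] at h'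
    rw [eval_gram, pow_two]
    exact h'
  have key : ∀ x z : ℝ, x ^ 2 = invariants s 0 → z ^ 2 = eval (invariants s) gram →
      (invariants s 0 * eval (invariants s) gram) ^ N * eval (coords s) f =
        eval (invariants s) G₀ + x * eval (invariants s) G₁ + z * eval (invariants s) G₂ +
          x * z * eval (invariants s) G₃ := by
    intro x z hx hz
    obtain ⟨g, hg⟩ := exists_smul_eq_slice s _ x z rfl hI hd hx hz
    rw [← hG _ _ x z rfl hI hd hx hz, ← hg, hf g s]
  have hx := Real.sq_sqrt hI'
  have hz := Real.sq_sqrt hd'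
  set x := √(invariants s 0)
  set z := √(eval (invariants s) gram)
  have h1 := key x z hx hz
  have h2 := key (-x) z (by rw [neg_sq, hx]) hz
  have h3 := key x (-z) hx (by rw [neg_sq, hz])
  have h4 := key (-x) (-z) (by rw [neg_sq, hx]) (by rw [neg_sq, hz])
  -- In the sum over the four sign choices only `G₀` survives.
  linarith

/-! ### Cancelling the denominators with complex points -/

/-- The values of the six invariants at a point of `ℂ^12`. -/
def complexInvariants (w : Coord 2 → ℂ) : Fin 6 → ℂ :=
  let a : Fin 2 → Fin 3 → ℂ := fun i n => w (i, Sum.inl n)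
  let b : Fin 2 → Fin 3 → ℂ := fun i n => w (i, Sum.inr n)
  ![a 0 ⬝ᵥ a 0, a 0 ⬝ᵥ a 1, a 1 ⬝ᵥ a 1, a 0 ⬝ᵥ b 0, a 1 ⬝ᵥ b 1, a 0 ⬝ᵥ b 1 + a 1 ⬝ᵥ b 0]

theorem aeval_aeval_gens (w : Coord 2 → ℂ) (P : MvPolynomial (Fin 6) ℝ) :
    aeval w (aeval gens P) = aeval (complexInvariants w) P := by
  have : (aeval w).comp (aeval (R := ℝ) gens) = aeval (complexInvariants w) := by
    ext i
    fin_cases i <;>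
      simp [gens, complexInvariants, omegaVar, vVar, dotProduct, Fin.sum_univ_three]
  simpa using DFunLike.congr_fun this P

/-- If a multiple `φ D * h` of `φ D` is a polynomial `φ P` in the generators, then `P` vanishes
at the real values of the invariants at complex points where `D` vanishes. -/
theorem eval_eq_zero_of_mul_eq {D P : MvPolynomial (Fin 6) ℝ} {h : MvPolynomial (Coord 2) ℝ}
    (H : aeval gens D * h = aeval gens P) (w : Coord 2 → ℂ) (I : Fin 6 → ℝ)
    (hw : complexInvariants w = fun i => (I i : ℂ)) (hD : eval I D = 0) : eval I P = 0 := by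
  have hI (Q : MvPolynomial (Fin 6) ℝ) :
      aeval (complexInvariants w) Q = ((eval I Q : ℝ) : ℂ) := by
    rw [hw]
    have := MvPolynomial.aeval_algebraMap_apply (A := ℝ) ℂ I Q
    simpa [MvPolynomial.aeval_eq_eval, Function.comp_def] using this
  have := congrArg (aeval w) H
  rw [map_mul, aeval_aeval_gens, aeval_aeval_gens, hI, hI, hD] at this
  simpa using this.symm

theorem exists_eq_X_zero_mul_add_rename (P : MvPolynomial (Fin 6) ℝ) :
    ∃ (Q : MvPolynomial (Fin 6) ℝ) (P₀ : MvPolynomial (Fin 5) ℝ),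
      P = X 0 * Q + rename (Fin.succAbove 0) P₀ := by
  induction P using MvPolynomial.induction_on with
  | C r => exact ⟨0, C r, by simp⟩
  | add f g hf hg =>
    obtain ⟨Q, P₀, rfl⟩ := hf
    obtain ⟨Q', P₀', rfl⟩ := hg
    exact ⟨Q + Q', P₀ + P₀', by simp only [map_add]; ring⟩
  | mul_X f i hf =>
    obtain ⟨Q, P₀, rfl⟩ := hf
    obtain rfl | ⟨j, rfl⟩ := Fin.eq_self_or_eq_succAbove 0 i
    · exact ⟨X 0 * Q + rename (Fin.succAbove 0) P₀, 0, by simp only [map_zero]; ring⟩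
    · exact ⟨Q * X (Fin.succAbove 0 j), P₀ * X j, by
        simp only [map_mul, rename_X]; ring⟩

/-- Division with remainder in `X 1`, in which `gram` is quadratic with leading coefficient `-1`. -/
theorem exists_eq_gram_mul_add_rename (P : MvPolynomial (Fin 6) ℝ) :
    ∃ (Q : MvPolynomial (Fin 6) ℝ) (P₀ P₁ : MvPolynomial (Fin 5) ℝ),
      P = gram * Q + rename (Fin.succAbove 1) P₀ + X 1 * rename (Fin.succAbove 1) P₁ := by
  induction P using MvPolynomial.induction_on with
  | C r => exact ⟨0, C r, 0, by simp⟩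
  | add f g hf hg =>
    obtain ⟨Q, P₀, P₁, rfl⟩ := hf
    obtain ⟨Q', P₀', P₁', rfl⟩ := hg
    exact ⟨Q + Q', P₀ + P₀', P₁ + P₁', by simp only [map_add]; ring⟩
  | mul_X f i hf =>
    obtain ⟨Q, P₀, P₁, rfl⟩ := hf
    obtain rfl | ⟨j, rfl⟩ := Fin.eq_self_or_eq_succAbove 1 i
    -- Uses `X 1 ^ 2 = X 0 * X 2 - gram`; the variable `X 1` of the five-variable ring stands for `X
    -- 2`.
    · refine ⟨X 1 * Q - rename (Fin.succAbove 1) P₁, X 0 * X 1 * P₁, P₀, ?_⟩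
      have h0 : Fin.succAbove (1 : Fin 6) 0 = 0 := rfl
      have h1 : Fin.succAbove (1 : Fin 6) 1 = 2 := rfl
      simp only [map_mul, rename_X, h0, h1, gram]
      ring
    · exact ⟨Q * X (Fin.succAbove 1 j), P₀ * X j, P₁ * X j, by
        simp only [map_mul, rename_X]; ring⟩

/-- With `ω₁ = (1, i, 0)` isotropic, the other five invariants take any real values with `ω₁·ω₂ ≠
0`, so the part of `P` free of `X 0` is zero. -/
theorem mem_range_of_gens_zero_mul {h : MvPolynomial (Coord 2) ℝ}
    (H : gens 0 * h ∈ (aeval (R := ℝ) gens).range) : h ∈ (aeval (R := ℝ) gens).range := by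
  obtain ⟨P, hP⟩ := H
  change aeval gens P = _ at hP
  obtain ⟨Q, P₀, rfl⟩ := exists_eq_X_zero_mul_add_rename P
  have h0 : P₀ = 0 := by
    refine MvPolynomial.funext_set (fun _ => {0}ᶜ)
      (fun _ => (Set.finite_singleton 0).infinite_compl) fun y hy => ?_
    have hb : y 0 ≠ 0 := hy 0 trivial
    have hb' : (y 0 : ℂ) ≠ 0 := by exact_mod_cast hb
    -- For `ω₂ = (α, iβ, 0)`, these solve `ω₁·ω₂ = α - β = y 0` and `ω₂·ω₂ = α ^ 2 - β ^ 2 = y 1`;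
    -- `k` is the value that `ω₁·v₂` must take.
    let α : ℝ := (y 1 / y 0 + y 0) / 2
    let β : ℝ := (y 1 / y 0 - y 0) / 2
    let k : ℝ := y 4 - α * y 2
    have h1 : α - β = y 0 := by simp only [α, β]; ring
    have h2 : α ^ 2 - β ^ 2 = y 1 := by simp only [α, β]; field_simp; ring
    have h1' : (α : ℂ) - β = y 0 := by exact_mod_cast h1
    have h2' : (α : ℂ) ^ 2 - β ^ 2 = y 1 := by exact_mod_cast h2
    have hk : (k : ℂ) = y 4 - α * y 2 := by simp [k]
    clear_value α β k
    have := eval_eq_zero_of_mul_eq (D := X 0) (h := h)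
      ((congrArg (· * h) (aeval_X gens 0)).trans hP.symm)
      (fun c => ![Sum.elim ![1, Complex.I, 0] ![(y 2 : ℂ), 0, 0],
        Sum.elim ![(α : ℂ), β * Complex.I, 0]
          ![(((y 3 - β * k) / y 0 : ℝ) : ℂ), ((y 3 - α * k) / y 0 : ℝ) * Complex.I, 0]] c.1 c.2)
      (Fin.insertNth 0 0 y) (by
        have hI := Complex.I_sq
        funext i
        fin_cases i
        · simp [complexInvariants, dotProduct, Fin.sum_univ_three, Fin.insertNth,
            Fin.succAboveCases]
        · simp [complexInvariants, dotProduct, Fin.sum_univ_three, Fin.insertNth,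
            Fin.succAboveCases]
          linear_combination h1' + (β : ℂ) * hI
        · simp [complexInvariants, dotProduct, Fin.sum_univ_three, Fin.insertNth,
            Fin.succAboveCases]
          linear_combination h2' + (β : ℂ) ^ 2 * hI
        · simp [complexInvariants, dotProduct, Fin.sum_univ_three, Fin.insertNth,
            Fin.succAboveCases]
        · simp [complexInvariants, dotProduct, Fin.sum_univ_three, Fin.insertNth,
            Fin.succAboveCases]
          field_simp
          linear_combination (y 3 : ℂ) * h1' + (β * (y 3 - α * k) : ℂ) * hI
        · simp [complexInvariants, dotProduct, Fin.sum_univ_three, Fin.insertNth,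
            Fin.succAboveCases]
          field_simp
          linear_combination (y 3 - α * k : ℂ) * hI + (k : ℂ) * h1' + (y 0 : ℂ) * hk) (by simp)
    have hc : (Fin.insertNth 0 0 y : Fin 6 → ℝ) ∘ Fin.succAbove 0 = y := by
      funext j; simp
    rw [map_add, map_mul, eval_X, eval_rename, hc] at this
    simpa using this
  subst h0
  refine ⟨Q, mul_left_cancel₀ gens_zero_ne_zero ?_⟩
  rw [← hP]
  simp

/-- The vectors `ω₁ = (1, i, s)` and `ω₂ = (0, 0, t)` are independent but have degenerate Gram
matrix, which leaves the invariants involving `v` free. The remainder `P₀ + X 1 * P₁` vanishes at `X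
1 = s * t`; changing the sign of `s` separates its two terms. -/
theorem mem_range_of_gram_mul {h : MvPolynomial (Coord 2) ℝ}
    (H : aeval gens gram * h ∈ (aeval (R := ℝ) gens).range) :
    h ∈ (aeval (R := ℝ) gens).range := by
  obtain ⟨P, hP⟩ := H
  change aeval gens P = _ at hP
  obtain ⟨Q, P₀, P₁, rfl⟩ := exists_eq_gram_mul_add_rename P
  have key : ∀ y ∈ Set.pi Set.univ (fun _ : Fin 5 => Set.Ioi (0 : ℝ)),
      eval y P₀ = 0 ∧ eval y P₁ = 0 := by
    intro y hy
    have ha : 0 < y 0 := hy 0 trivial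
    have hc : 0 < y 1 := hy 1 trivial
    have main (s t : ℝ) (hs : s ^ 2 = y 0) (ht : t ^ 2 = y 1) :
        eval y P₀ + s * t * eval y P₁ = 0 := by
      have ht0 : t ≠ 0 := by rintro rfl; rw [← ht] at hc; simp at hc
      have ht' : (t : ℂ) ≠ 0 := by exact_mod_cast ht0
      have hs' : (s : ℂ) ^ 2 = y 0 := by exact_mod_cast hs
      have ht'' : (t : ℂ) ^ 2 = y 1 := by exact_mod_cast ht
      have hg : eval (Fin.insertNth 1 (s * t) y : Fin 6 → ℝ) gram = 0 := by
        rw [eval_gram]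
        change y 0 * y 1 - (s * t) ^ 2 = 0
        rw [← hs, ← ht]; ring
      have := eval_eq_zero_of_mul_eq hP.symm
        (fun c => ![Sum.elim ![1, Complex.I, (s : ℂ)] ![(y 2 : ℂ), 0, 0],
          Sum.elim ![0, 0, (t : ℂ)] ![(y 4 : ℂ) - s * y 3 / t, 0, (y 3 : ℂ) / t]] c.1 c.2)
        (Fin.insertNth 1 (s * t) y) (by
          have hI := Complex.I_sq
          funext i
          fin_cases i
          · simp [complexInvariants, dotProduct, Fin.sum_univ_three, Fin.insertNth,
              Fin.succAboveCases]
            linear_combination hs'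
          · simp [complexInvariants, dotProduct, Fin.sum_univ_three, Fin.insertNth,
              Fin.succAboveCases]
          · simp [complexInvariants, dotProduct, Fin.sum_univ_three, Fin.insertNth,
              Fin.succAboveCases]
            linear_combination ht''
          · simp [complexInvariants, dotProduct, Fin.sum_univ_three, Fin.insertNth,
              Fin.succAboveCases]
          · simp [complexInvariants, dotProduct, Fin.sum_univ_three, Fin.insertNth,
              Fin.succAboveCases]
            field_simp
          · simp [complexInvariants, dotProduct, Fin.sum_univ_three, Fin.insertNth,
              Fin.succAboveCases]
            ring) hg
      have hc : (Fin.insertNth 1 (s * t) y : Fin 6 → ℝ) ∘ Fin.succAbove 1 = y := by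
        funext j; simp
      simpa [eval_rename, hc, hg] using this
    have hs := Real.sq_sqrt ha.le
    have ht := Real.sq_sqrt hc.le
    have h1 := main _ _ hs ht
    have h2 := main (-√(y 0)) _ (by rw [neg_sq, hs]) ht
    have hpos : 0 < √(y 0) * √(y 1) := mul_pos (Real.sqrt_pos.2 ha) (Real.sqrt_pos.2 hc)
    refine ⟨by linarith, ?_⟩
    refine (mul_eq_zero.1 (?_ : √(y 0) * √(y 1) * eval y P₁ = 0)).resolve_left hpos.ne'
    linarith
  have h0 : P₀ = 0 := MvPolynomial.funext_set _ (fun _ => Set.Ioi_infinite 0) fun y hy => by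
    simpa using (key y hy).1
  have h1 : P₁ = 0 := MvPolynomial.funext_set _ (fun _ => Set.Ioi_infinite 0) fun y hy => by
    simpa using (key y hy).2
  subst h0 h1
  refine ⟨Q, mul_left_cancel₀ aeval_gens_gram_ne_zero ?_⟩
  rw [← hP]
  simp

theorem mem_range_of_pow_mul {h : MvPolynomial (Coord 2) ℝ} (N : ℕ)
    (H : (gens 0 * aeval gens gram) ^ N * h ∈ (aeval (R := ℝ) gens).range) :
    h ∈ (aeval (R := ℝ) gens).range := by
  induction N with
  | zero => simpa using H
  | succ N ih =>
    rw [pow_succ', mul_assoc, mul_assoc] at H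
    exact ih (mem_range_of_gram_mul (mem_range_of_gens_zero_mul H))

end Screws

theorem theorem4 :
    Screws.invariantRing 2 =
      Algebra.adjoin ℝ
        ({p | ∃ i j : Fin 2, p = Screws.omegaVar i ⬝ᵥ Screws.omegaVar j} ∪
          {p | ∃ i : Fin 2, p = Screws.omegaVar i ⬝ᵥ Screws.vVar i} ∪
          {Screws.omegaVar 0 ⬝ᵥ Screws.vVar 1 + Screws.omegaVar 1 ⬝ᵥ Screws.vVar 0}) := by
  rw [Screws.adjoin_eq_range_aeval_gens]
  refine le_antisymm (fun f hf => ?_) Screws.range_aeval_gens_le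
  obtain ⟨N, hN⟩ := Screws.exists_pow_mul_mem_range hf
  exact Screws.mem_range_of_pow_mul N hN
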